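/- For $n\ge 2$ let $\mathbb Z_n^4=(\mathbb Z/n\mathbb Z)^4$ be the four-dimensional discrete torus. A random walk on $\mathbb Z_n^4$ is a Markov chain $(X_t)_{t=0}^\infty$ in discrete time, with an arbitrary initial distribution, that at each step stays in its current position with probability $1/2$ and otherwise moves by one of the eight vectors $\pm e_1,\dots,\pm e_4$ (taken modulo $n$), each with probability $1/16$. Proposition. For every constant $C'>0$ there is a constant $C>0$, depending only on $C'$, such that the following holds for all integers $n\ge 2$. Let $(X_t)_{t=0}^\infty$ and $(Y_t)_{t=0}^\infty$ be independent random walks on $\mathbb Z_n^4$, and assume that $Y_0$ has the uniform distribution on $\mathbb Z_n^4$. If $K$ and $L$ are non-negative integers with $K\ge C'n\log n$ and $L\ge C'n\log n$, then $$P\big(X_s=Y_t\text{ for some } 0\le s\le K\text{ and } 0\le t\le L\big)\le \frac{C\,K\,L}{n^4\log n}.$$ -/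

import Mathlib

open MeasureTheory ProbabilityTheory

/-- The vertex set of the four-dimensional discrete torus of side length `n`,
with coordinates taken modulo `n`. -/
abbrev Torus4 (n : ℕ) : Type := Fin 4 → ZMod n

/-- One-step transition probabilities of the random walk on the torus: stay put with
probability `1/2`, and add each of the eight vectors `± e_i` with probability `1/16`
(contributions add up when two of these vectors agree modulo `n`). -/
noncomputable def walkStep (n : ℕ) (x y : Torus4 n) : ℝ :=
  (if y = x then 1 / 2 else 0) +
    ∑ i : Fin 4, ((if y = x + Pi.single i 1 then 1 / 16 else 0) +
      (if y = x - Pi.single i 1 then 1 / 16 else 0))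

/-- `X = (X_t)_{t ≥ 0}` is a random walk on the torus, with an arbitrary initial distribution:
a Markov chain whose transition probabilities are `walkStep n`. The field `step` is the Markov
property given the whole past, multiplied by the probability of that past. -/
structure IsTorusWalk (n : ℕ) {Ω : Type*} [MeasurableSpace Ω] (μ : Measure Ω)
    (X : ℕ → Ω → Torus4 n) : Prop where
  measurable : ∀ t, Measurable (X t)
  step : ∀ (t : ℕ) (x : ℕ → Torus4 n),
    μ.real {ω | ∀ s ≤ t + 1, X s ω = x s} =
      μ.real {ω | ∀ s ≤ t, X s ω = x s} * walkStep n (x t) (x (t + 1))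

/-! The expected number of pairs `(s, t)` with `X s = Y t` is about `K L / n ^ 4`, because `Y` is
uniform at every time. The saving of `log n` comes from clustering: in dimension four one meeting is
typically followed by about `log n` further ones.

Clustering is measured by the local score of `Y` at time `t`: given the path of `Y`, it sums, over
`1 ≤ j ≤ T`, the probabilities that a fresh walk from `Y t` is at `Y (t + j)` at a time in `[j, 2
j)`. Return probabilities are of order `m ^ (-2)`, so window `j` contributes a mean of order `1 / j`
and the mean score is at least of order `log T`. Confining the fresh walk to these windows makes the
covariance of contributions `j` and `k` at most of order `1 / max j k ^ 2`, so the variance is only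
`O(log T)`.

Meetings are split by the score at the meeting point. At a low score, Chebyshev gives an extra
factor `O(1 / log T)` (`measure_low_score_le`), and a union bound over all `(s, t)` suffices. For
high scores, the path of `Y` is frozen: when `X` first hits a point of high score, the Markov
property yields an expected number of later coincidences of order `log T` (`mul_measure_hit_le`),
while the total expected number is at most `(K + 2T)(L + T + 1) / n ^ 4`. Taking `T` to be the
integer square root of `n` makes `log T` comparable to `log n`; the lower bounds on `K` and `L`
absorb `T`, except for boundedly many `n`, which are handled by enlarging the constant. -/

namespace TorusWalk

open Finset

section Kernel

/-! ### The transition matrix and its Fourier expansion -/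

/-- The transition matrix of the walk. -/
noncomputable def stepMatrix (n : ℕ) : Matrix (Torus4 n) (Torus4 n) ℝ :=
  Matrix.of (walkStep n)

/-- The eigenvalue of the transition matrix at the frequency `ξ`. -/
noncomputable def eigenval (n : ℕ) [NeZero n] (ξ : Torus4 n) : ℝ :=
  1 / 2 + ∑ i, (ZMod.stdAddChar (ξ i)).re / 8

/-- The character of the torus with frequency `ξ`. -/
noncomputable def character (n : ℕ) [NeZero n] (ξ x : Torus4 n) : ℂ :=
  ∏ i, ZMod.stdAddChar (ξ i * x i)

/-- The return probability after `m` steps. -/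
noncomputable def returnProb (n : ℕ) [NeZero n] (m : ℕ) : ℝ :=
  ((n : ℝ) ^ 4)⁻¹ * ∑ ξ : Torus4 n, eigenval n ξ ^ m

lemma walkStep_nonneg {n : ℕ} (x y : Torus4 n) : 0 ≤ walkStep n x y := by
  unfold walkStep
  refine add_nonneg (by split_ifs <;> norm_num) (sum_nonneg fun i _ => add_nonneg ?_ ?_) <;>
    split_ifs <;> norm_num

lemma walkStep_comm {n : ℕ} (x y : Torus4 n) : walkStep n x y = walkStep n y x := by
  unfold walkStep
  congr 1
  · simp [eq_comm]
  · refine sum_congr rfl fun i _ => ?_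
    rw [add_comm]
    congr 2
    · rw [eq_sub_iff_add_eq, eq_comm (a := x)]
    · rw [eq_sub_iff_add_eq, eq_comm (b := y)]

variable {n : ℕ} [NeZero n]

lemma sum_walkStep_mul {R : Type*} [CommRing R] [Algebra ℝ R] (x : Torus4 n) (f : Torus4 n → R) :
    ∑ w, algebraMap ℝ R (walkStep n x w) * f w = algebraMap ℝ R (1 / 2) * f x +
      ∑ i : Fin 4, algebraMap ℝ R (1 / 16) *
        (f (x + Pi.single i 1) + f (x - Pi.single i 1)) := by
  simp only [walkStep, map_add, map_sum, add_mul, sum_mul, sum_add_distrib, apply_ite (algebraMap ℝ R),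
    map_zero, ite_mul, zero_mul, sum_ite_eq', mem_univ, if_true, mul_add]
  congr 1
  congr 1
  all_goals
    rw [sum_comm]
    simp

lemma norm_character (ξ x : Torus4 n) : ‖character n ξ x‖ = 1 := by
  simp [character, AddChar.norm_apply]

lemma character_add (ξ x y : Torus4 n) :
    character n ξ (x + y) = character n ξ x * character n ξ y := by
  simp [character, mul_add, AddChar.map_add_eq_mul, prod_mul_distrib]

lemma character_neg_single (ξ : Torus4 n) (i : Fin 4) :
    character n ξ (-Pi.single i 1) = (starRingEnd ℂ) (ZMod.stdAddChar (ξ i)) := by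
  rw [character, prod_eq_single i]
  · rw [← AddChar.map_neg_eq_conj]
    simp
  · intro j _ hj
    simp [hj]
  · simp

lemma character_single (ξ : Torus4 n) (i : Fin 4) :
    character n ξ (Pi.single i 1) = ZMod.stdAddChar (ξ i) := by
  rw [character, prod_eq_single i]
  · simp
  · intro j _ hj
    simp [hj]
  · simp

lemma sum_walkStep_character (ξ x z : Torus4 n) :
    ∑ w, (walkStep n x w : ℂ) * character n ξ (z - w) =
      (eigenval n ξ : ℂ) * character n ξ (z - x) := by
  have h := sum_walkStep_mul (R := ℂ) x (fun w => character n ξ (z - w))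
  simp only [Complex.coe_algebraMap] at h
  rw [h]
  have h1 : ∀ i : Fin 4, character n ξ (z - (x + Pi.single i 1)) +
      character n ξ (z - (x - Pi.single i 1)) =
        character n ξ (z - x) * (2 * (ZMod.stdAddChar (ξ i)).re : ℝ) := by
    intro i
    rw [show z - (x + Pi.single i 1) = (z - x) + -Pi.single i 1 by abel,
      show z - (x - Pi.single i 1) = (z - x) + Pi.single i 1 by abel, character_add, character_add,
      character_neg_single, character_single, ← mul_add, add_comm, Complex.add_conj]
  simp_rw [h1, eigenval]
  push_cast
  rw [add_mul, sum_mul]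
  congr 1
  refine sum_congr rfl fun i _ => ?_
  ring

lemma sum_character (x : Torus4 n) :
    ∑ ξ, character n ξ x = if x = 0 then (n : ℂ) ^ 4 else 0 := by
  have h : ∑ ξ : Torus4 n, character n ξ x = ∏ i : Fin 4, ∑ a : ZMod n, ZMod.stdAddChar (a * x i) := by
    rw [prod_univ_sum]
    simp [character]
  rw [h]
  simp_rw [AddChar.sum_mulShift _ (ZMod.isPrimitive_stdAddChar n)]
  split_ifs with hx
  · simp [hx, ZMod.card]
  · obtain ⟨i, hi⟩ := Function.ne_iff.mp hx
    exact prod_eq_zero (mem_univ i) (by simpa [NeZero.ne n] using hi)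

/-- The characters diagonalise the transition matrix (`sum_walkStep_character`), and their
orthogonality (`sum_character`) gives the case `m = 0`. -/
lemma stepMatrix_pow_fourier (m : ℕ) (x z : Torus4 n) :
    (((stepMatrix n ^ m) x z : ℝ) : ℂ) =
      ((n : ℂ) ^ 4)⁻¹ * ∑ ξ, (eigenval n ξ : ℂ) ^ m * character n ξ (z - x) := by
  have hn : (n : ℂ) ≠ 0 := by exact_mod_cast NeZero.ne n
  induction m generalizing x with
  | zero =>
    simp only [pow_zero, one_mul, sum_character, Matrix.one_apply, sub_eq_zero, eq_comm (a := z)]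
    split_ifs <;> simp [hn]
  | succ m ih =>
    rw [pow_succ', Matrix.mul_apply]
    push_cast
    simp_rw [ih, mul_sum]
    rw [sum_comm]
    refine sum_congr rfl fun ξ _ => ?_
    rw [pow_succ (eigenval n ξ : ℂ), mul_assoc _ (eigenval n ξ : ℂ), ← sum_walkStep_character, mul_sum, mul_sum]
    refine sum_congr rfl fun w _ => ?_
    rw [stepMatrix, Matrix.of_apply]
    ring

lemma stepMatrix_pow_diag (m : ℕ) (x : Torus4 n) : (stepMatrix n ^ m) x x = returnProb n m := by
  have h := stepMatrix_pow_fourier m x x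
  have h1 : ∀ ξ : Torus4 n, character n ξ 0 = 1 := fun ξ => by simp [character]
  simp only [sub_self, h1, mul_one] at h
  unfold returnProb
  apply Complex.ofReal_injective
  push_cast
  exact h

lemma abs_re_stdAddChar_le (a : ZMod n) : |(ZMod.stdAddChar a).re| ≤ 1 := by
  refine (Complex.abs_re_le_norm _).trans ?_
  rw [AddChar.norm_apply]

/-- This is where laziness enters. Nonnegative eigenvalues make return probabilities monotone in
time and maximal among all transition probabilities. -/
lemma eigenval_nonneg (ξ : Torus4 n) : 0 ≤ eigenval n ξ := by
  have h := fun i => neg_le_of_abs_le (abs_re_stdAddChar_le (ξ i))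
  simp only [eigenval, Fin.sum_univ_four]
  linarith [h 0, h 1, h 2, h 3]

lemma eigenval_le_one (ξ : Torus4 n) : eigenval n ξ ≤ 1 := by
  have h := fun i => le_of_abs_le (abs_re_stdAddChar_le (ξ i))
  simp only [eigenval, Fin.sum_univ_four]
  linarith [h 0, h 1, h 2, h 3]

lemma returnProb_nonneg (m : ℕ) : 0 ≤ returnProb n m :=
  mul_nonneg (by positivity) (sum_nonneg fun ξ _ => pow_nonneg (eigenval_nonneg ξ) _)

lemma returnProb_antitone : Antitone (returnProb n) := fun a b hab => by
  unfold returnProb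
  gcongr ?_ * ∑ ξ, ?_ with ξ
  exact pow_le_pow_of_le_one (eigenval_nonneg ξ) (eigenval_le_one ξ) hab

lemma stepMatrix_pow_le (m : ℕ) (x z : Torus4 n) : (stepMatrix n ^ m) x z ≤ returnProb n m := by
  refine (le_abs_self _).trans ?_
  have h0 : |(stepMatrix n ^ m) x z| = ‖(((stepMatrix n ^ m) x z : ℝ) : ℂ)‖ :=
    (Complex.norm_real _).symm
  rw [h0, stepMatrix_pow_fourier, norm_mul, returnProb]
  have h : ‖((n : ℂ) ^ 4)⁻¹‖ = ((n : ℝ) ^ 4)⁻¹ := by simp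
  rw [h]
  gcongr
  refine (norm_sum_le _ _).trans (le_of_eq (sum_congr rfl fun ξ _ => ?_))
  rw [norm_mul, norm_character, mul_one, norm_pow, Complex.norm_real,
    Real.norm_of_nonneg (eigenval_nonneg ξ)]

lemma stepMatrix_pow_nonneg (m : ℕ) (x z : Torus4 n) : 0 ≤ (stepMatrix n ^ m) x z := by
  induction m generalizing x with
  | zero => rw [pow_zero, Matrix.one_apply]; split_ifs <;> norm_num
  | succ m ih =>
    rw [pow_succ', Matrix.mul_apply]
    exact sum_nonneg fun w _ => mul_nonneg (walkStep_nonneg x w) (ih w)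

lemma stepMatrix_pow_comm (m : ℕ) (x z : Torus4 n) :
    (stepMatrix n ^ m) x z = (stepMatrix n ^ m) z x := by
  have h : (stepMatrix n).IsSymm := Matrix.IsSymm.ext fun i j => walkStep_comm j i
  exact (h.pow m).apply z x

lemma sum_stepMatrix_pow (m : ℕ) (x : Torus4 n) : ∑ z, (stepMatrix n ^ m) x z = 1 := by
  induction m generalizing x with
  | zero => simp [Matrix.one_apply]
  | succ m ih =>
    simp_rw [pow_succ', Matrix.mul_apply]
    rw [sum_comm]
    simp_rw [← mul_sum, ih]
    have h := sum_walkStep_mul (R := ℝ) x (fun _ => 1)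
    simp only [Algebra.algebraMap_self, RingHom.id_apply, mul_one] at h
    simp only [stepMatrix, Matrix.of_apply, mul_one, h]
    norm_num [Fin.sum_univ_four]

/-! ### Bounds on the return probabilities -/

lemma re_stdAddChar (a : ZMod n) :
    (ZMod.stdAddChar a).re = Real.cos (2 * Real.pi * a.valMinAbs / n) := by
  conv_lhs => rw [← ZMod.coe_valMinAbs a]
  rw [ZMod.stdAddChar_coe, show (2 * Real.pi * Complex.I * (a.valMinAbs : ℤ) / n : ℂ) =
    ((2 * Real.pi * a.valMinAbs / n : ℝ) : ℂ) * Complex.I by push_cast; ring,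
    Complex.exp_ofReal_mul_I_re]

lemma re_stdAddChar_le (a : ZMod n) :
    (ZMod.stdAddChar a).re ≤ 1 - 8 * ((a.valMinAbs : ℝ) / n) ^ 2 := by
  have hn : (0 : ℝ) < n := by exact_mod_cast NeZero.pos n
  have h : |(a.valMinAbs : ℝ)| * 2 ≤ n := by
    have h1 := ZMod.valMinAbs_mem_Ioc a
    have h2 : |a.valMinAbs| * 2 ≤ n := by
      rcases abs_cases a.valMinAbs with h | h <;> simp only [Set.mem_Ioc] at h1 <;> omega
    exact_mod_cast h2
  rw [re_stdAddChar]
  -- The quadratic bound `cos θ ≤ 1 - 2 θ² / π²` on `[-π, π]`, at `θ = 2 π v / n`, produces the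
  -- constant `8`.
  refine (Real.cos_le_one_sub_mul_cos_sq ?_).trans (le_of_eq ?_)
  · rw [abs_div, abs_mul, abs_of_pos hn, abs_of_pos Real.two_pi_pos, div_le_iff₀ hn]
    nlinarith [Real.pi_pos]
  · have := Real.pi_pos.ne'
    field_simp
    ring

lemma le_re_stdAddChar (a : ZMod n) :
    1 - 20 * ((a.valMinAbs : ℝ) / n) ^ 2 ≤ (ZMod.stdAddChar a).re := by
  rw [re_stdAddChar]
  refine le_trans ?_ Real.one_sub_sq_div_two_le_cos
  have h : (2 * Real.pi * a.valMinAbs / n : ℝ) ^ 2 / 2 =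
    2 * Real.pi ^ 2 * ((a.valMinAbs : ℝ) / n) ^ 2 := by ring
  rw [h]
  have h2 : Real.pi ^ 2 ≤ 10 := by nlinarith [Real.pi_lt_d2, Real.pi_pos]
  nlinarith [sq_nonneg ((a.valMinAbs : ℝ) / n)]

/-- Since `(A + x) ^ 2 ≤ 2 (A ^ 2 + x ^ 2)`, each term is dominated by a term of a telescoping
series in `1 / (A + k)`. -/
lemma sum_inv_one_add_sq_le {A : ℝ} (hA : 0 < A) (N : ℕ) :
    ∑ k ∈ range N, (1 + (((k : ℝ) + 1) / A) ^ 2)⁻¹ ≤ 2 * A := by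
  have h : ∑ k ∈ range N, (1 + (((k : ℝ) + 1) / A) ^ 2)⁻¹ ≤
      2 * A ^ 2 * (1 / A - 1 / (A + N)) := by
    induction N with
    | zero => simp
    | succ N ih =>
      rw [sum_range_succ]
      have : (1 + (((N : ℝ) + 1) / A) ^ 2)⁻¹ ≤ 2 * A ^ 2 * (1 / (A + N) - 1 / (A + (N + 1))) := by
        rw [div_sub_div _ _ (by positivity) (by positivity), inv_eq_one_div, ← mul_div_assoc,
          div_le_div_iff₀ (by positivity) (by positivity)]
        have : A ^ 2 * (1 + (((N : ℝ) + 1) / A) ^ 2) = A ^ 2 + (N + 1) ^ 2 := by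
          field_simp
        nlinarith [sq_nonneg (A - (N + 1)), (Nat.cast_nonneg N : (0 : ℝ) ≤ N)]
      push_cast
      linarith
  refine h.trans ?_
  have h2 : 0 ≤ 1 / (A + N) := by positivity
  have h3 : 2 * A ^ 2 * (1 / A) = 2 * A := by field_simp
  nlinarith [mul_nonneg (sq_nonneg A) h2]

lemma sum_valMinAbs_le (f : ℝ → ℝ) (hf : ∀ x, 0 ≤ f x) :
    ∑ a : ZMod n, f (|(a.valMinAbs : ℝ)|) ≤ f 0 + 2 * ∑ k ∈ range n, f ((k : ℝ) + 1) := by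
  have hinj : ∀ c : ℤ, ∑ a : ZMod n, (if a.valMinAbs = c then (1 : ℝ) else 0) ≤ 1 := by
    intro c
    rw [sum_boole]
    have : #{a : ZMod n | a.valMinAbs = c} ≤ 1 := card_le_one.mpr fun a ha b hb =>
      ZMod.injective_valMinAbs ((mem_filter.mp ha).2.trans (mem_filter.mp hb).2.symm)
    exact_mod_cast this
  have hpt : ∀ a : ZMod n, f (|(a.valMinAbs : ℝ)|) ≤ (if a.valMinAbs = 0 then 1 else 0) * f 0 +
      ∑ k ∈ range n, ((if a.valMinAbs = (k : ℤ) + 1 then 1 else 0) +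
        (if a.valMinAbs = -((k : ℤ) + 1) then 1 else 0)) * f ((k : ℝ) + 1) := by
    intro a
    have hs : ∀ k ∈ range n, 0 ≤ ((if a.valMinAbs = (k : ℤ) + 1 then (1 : ℝ) else 0) +
        (if a.valMinAbs = -((k : ℤ) + 1) then 1 else 0)) * f ((k : ℝ) + 1) := fun k _ =>
      mul_nonneg (add_nonneg (by split_ifs <;> norm_num) (by split_ifs <;> norm_num)) (hf _)
    have h1 := ZMod.valMinAbs_mem_Ioc a
    simp only [Set.mem_Ioc] at h1
    have hn := NeZero.pos n
    by_cases h0 : a.valMinAbs = 0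
    · have := sum_nonneg hs
      simp only [h0, if_true, Int.cast_zero, abs_zero, one_mul] at this ⊢
      linarith
    · have hk : a.valMinAbs.natAbs - 1 ∈ range n := by rw [mem_range]; omega
      have hc : ((a.valMinAbs.natAbs - 1 : ℕ) : ℤ) + 1 = |a.valMinAbs| := by
        rcases abs_cases a.valMinAbs with h | h <;> omega
      have hc' : ((a.valMinAbs.natAbs - 1 : ℕ) : ℝ) + 1 = |(a.valMinAbs : ℝ)| := by exact_mod_cast hc
      refine le_trans ?_ (le_trans (single_le_sum hs hk) (le_add_of_nonneg_left ?_))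
      · rw [hc', hc]
        refine le_mul_of_one_le_left (hf _) ?_
        rcases abs_choice a.valMinAbs with h | h
        · rw [h, if_pos rfl]
          exact le_add_of_nonneg_right (by split_ifs <;> norm_num)
        · rw [h, neg_neg, if_pos (rfl : a.valMinAbs = a.valMinAbs)]
          exact le_add_of_nonneg_left (by split_ifs <;> norm_num)
      · simp [h0]
  refine (sum_le_sum fun a _ => hpt a).trans ?_
  rw [sum_add_distrib, ← sum_mul, sum_comm, mul_sum]
  refine add_le_add (mul_le_of_le_one_left (hf _) (hinj 0)) (sum_le_sum fun k _ => ?_)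
  rw [← sum_mul, sum_add_distrib]
  refine mul_le_mul_of_nonneg_right ?_ (hf _)
  linarith [hinj ((k : ℤ) + 1), hinj (-((k : ℤ) + 1))]

/-- A Gaussian bound in each coordinate, weakened by `exp (-t) ≤ 1 / (1 + t)`. The product form lets
the sum over frequencies factor, and the rational weights can be summed by telescoping. -/
lemma eigenval_pow_le (m : ℕ) (ξ : Torus4 n) :
    eigenval n ξ ^ m ≤ ∏ i, (1 + (|((ξ i).valMinAbs : ℝ)| / (n / √m)) ^ 2)⁻¹ := by
  have h1 : eigenval n ξ ≤ Real.exp (-∑ i, (((ξ i).valMinAbs : ℝ) / n) ^ 2) := by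
    refine le_trans ?_ (Real.add_one_le_exp _)
    have h := fun i => re_stdAddChar_le (ξ i)
    simp only [eigenval, Fin.sum_univ_four]
    linarith [h 0, h 1, h 2, h 3]
  refine (pow_le_pow_left₀ (eigenval_nonneg ξ) h1 m).trans ?_
  rw [← Real.exp_nat_mul, mul_neg, mul_sum, ← sum_neg_distrib, Real.exp_sum]
  refine prod_le_prod (fun _ _ => (Real.exp_pos _).le) fun i _ => ?_
  rw [Real.exp_neg]
  refine inv_anti₀ (by positivity) ?_
  refine le_trans (le_of_eq ?_) (Real.add_one_le_exp _)
  rw [div_div_eq_mul_div, div_pow, mul_pow, sq_abs, Real.sq_sqrt (Nat.cast_nonneg m)]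
  ring

lemma returnProb_le {m : ℕ} (hm : 1 ≤ m) (hmn : m ≤ n ^ 2) : returnProb n m ≤ 625 / (m : ℝ) ^ 2 := by
  have hn : (0 : ℝ) < n := by exact_mod_cast NeZero.pos n
  have hm' : (0 : ℝ) < m := by exact_mod_cast hm
  have hs : 0 < √(m : ℝ) := Real.sqrt_pos.mpr hm'
  set A : ℝ := n / √m with hA
  have hA1 : 1 ≤ A := by
    rw [hA, one_le_div hs]
    exact Real.sqrt_le_iff.mpr ⟨hn.le, by exact_mod_cast hmn⟩
  -- The zero frequency contributes `1 ≤ A`, the others at most `4 A`; the fourth power of `5` is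
  -- the constant `625`.
  have h1 : ∑ a : ZMod n, (1 + (|(a.valMinAbs : ℝ)| / A) ^ 2)⁻¹ ≤ 5 * A := by
    refine (sum_valMinAbs_le (fun t => (1 + (t / A) ^ 2)⁻¹) (fun t => by positivity)).trans ?_
    have := sum_inv_one_add_sq_le (lt_of_lt_of_le one_pos hA1) n
    simp only [zero_div]
    norm_num
    linarith
  have h2 : ∑ ξ : Torus4 n, eigenval n ξ ^ m ≤ (5 * A) ^ 4 := by
    refine (sum_le_sum fun ξ _ => eigenval_pow_le m ξ).trans ?_
    have : ∑ ξ : Torus4 n, ∏ i, (1 + (|((ξ i).valMinAbs : ℝ)| / A) ^ 2)⁻¹ =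
        ∏ _i : Fin 4, ∑ a : ZMod n, (1 + (|(a.valMinAbs : ℝ)| / A) ^ 2)⁻¹ := by
      rw [prod_univ_sum]
      simp
    rw [this, prod_const, card_univ, Fintype.card_fin]
    exact pow_le_pow_left₀ (sum_nonneg fun a _ => by positivity) h1 4
  calc returnProb n m ≤ ((n : ℝ) ^ 4)⁻¹ * (5 * A) ^ 4 := by unfold returnProb; gcongr
    _ = 625 / (m : ℝ) ^ 2 := by
      have : √(m : ℝ) ^ 4 = (m : ℝ) ^ 2 := by
        rw [show 4 = 2 * 2 by norm_num, pow_mul, Real.sq_sqrt hm'.le]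
      rw [hA, mul_pow, div_pow, this]
      field_simp
      norm_num

/-- Only frequencies whose coordinates lie in `{0, …, ⌊B⌋}` are kept. There the eigenvalue is at
least `1 - 1 / (2 m)`, so by Bernoulli its `m`-th power is at least `1 / 2`; there are at least `B ^
4` such frequencies. -/
lemma le_returnProb {m : ℕ} (hm : 1 ≤ m) : 1 / (800 * (m : ℝ) ^ 2) ≤ returnProb n m := by
  have hn : (0 : ℝ) < n := by exact_mod_cast NeZero.pos n
  have hm' : (0 : ℝ) < m := by exact_mod_cast hm
  have hm1 : (1 : ℝ) ≤ m := by exact_mod_cast hm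
  set B : ℝ := n / √(20 * m) with hB
  have hB0 : 0 ≤ B := by positivity
  have hBsq : B ^ 2 = n ^ 2 / (20 * m) := by
    rw [hB, div_pow, Real.sq_sqrt (by positivity)]
  have hBn : 2 * B ≤ n := by
    refine abs_le_of_sq_le_sq' ?_ hn.le |>.2
    rw [mul_pow, hBsq, ← mul_div_assoc, div_le_iff₀ (by positivity)]
    nlinarith [sq_nonneg (n : ℝ)]
  have hfl : (⌊B⌋₊ : ℝ) ≤ B := Nat.floor_le hB0
  have hhalf : ⌊B⌋₊ ≤ n / 2 := by
    rw [Nat.le_div_iff_mul_le (by norm_num)]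
    have : (⌊B⌋₊ : ℝ) * 2 ≤ n := by linarith
    exact_mod_cast this
  set S : Finset (ZMod n) := (range (⌊B⌋₊ + 1)).image (fun k : ℕ => (k : ZMod n)) with hS
  have hv : ∀ k ∈ range (⌊B⌋₊ + 1), ((k : ZMod n)).valMinAbs = k := fun k hk =>
    ZMod.valMinAbs_natCast_of_le_half ((Nat.lt_succ_iff.mp (mem_range.mp hk)).trans hhalf)
  have hcard : B ≤ (S.card : ℝ) := by
    rw [hS, card_image_of_injOn]
    · rw [card_range]; push_cast; exact (Nat.lt_floor_add_one B).le
    · intro k hk l hl hkl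
      have := congrArg ZMod.valMinAbs hkl
      simp only [hv k hk, hv l hl] at this
      exact_mod_cast this
  have hSv : ∀ a ∈ S, ((a.valMinAbs : ℝ) / n) ^ 2 ≤ 1 / (20 * m) := by
    intro a ha
    obtain ⟨k, hk, rfl⟩ := mem_image.mp ha
    rw [hv k hk]
    have hkB : (k : ℝ) ≤ B := le_trans (by exact_mod_cast Nat.lt_succ_iff.mp (mem_range.mp hk)) hfl
    push_cast
    rw [div_pow, div_le_div_iff₀ (by positivity) (by positivity), one_mul]
    have : (k : ℝ) ^ 2 ≤ n ^ 2 / (20 * m) := hBsq ▸ pow_le_pow_left₀ (by positivity) hkB 2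
    rwa [le_div_iff₀ (by positivity)] at this
  have hl : ∀ ξ ∈ Fintype.piFinset (fun _ : Fin 4 => S), 1 / 2 ≤ eigenval n ξ ^ m := by
    intro ξ hξ
    have h0 : 1 - 1 / (2 * m) ≤ eigenval n ξ := by
      have h := fun i => le_re_stdAddChar (ξ i)
      have h' := fun i => hSv _ (Fintype.mem_piFinset.mp hξ i)
      have he : (1 : ℝ) / (2 * m) = 10 * (1 / (20 * m)) := by field_simp; norm_num
      rw [he]
      simp only [eigenval, Fin.sum_univ_four]
      linarith [h 0, h 1, h 2, h 3, h' 0, h' 1, h' 2, h' 3]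
    have h1 : 1 / (2 * (m : ℝ)) ≤ 1 / 2 := by
      apply one_div_le_one_div_of_le <;> linarith
    refine le_trans ?_ (pow_le_pow_left₀ (by linarith) h0 m)
    have := one_add_mul_le_pow (a := -(1 / (2 * (m : ℝ)))) (by linarith) m
    refine le_trans (le_of_eq ?_) this
    field_simp
    norm_num
  calc 1 / (800 * (m : ℝ) ^ 2) = ((n : ℝ) ^ 4)⁻¹ * (B ^ 4 * (1 / 2)) := by
        rw [show B ^ 4 = (B ^ 2) ^ 2 by ring, hBsq]
        field_simp
        norm_num
    _ ≤ ((n : ℝ) ^ 4)⁻¹ * ((S.card : ℝ) ^ 4 * (1 / 2)) := by gcongr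
    _ = ((n : ℝ) ^ 4)⁻¹ * ∑ ξ ∈ Fintype.piFinset (fun _ : Fin 4 => S), 1 / 2 := by
        rw [sum_const, Fintype.card_piFinset]
        simp
    _ ≤ ((n : ℝ) ^ 4)⁻¹ * ∑ ξ ∈ Fintype.piFinset (fun _ : Fin 4 => S), eigenval n ξ ^ m := by
        gcongr with ξ hξ
        exact hl ξ hξ
    _ ≤ returnProb n m := by
        unfold returnProb
        gcongr
        · exact fun ξ _ _ => pow_nonneg (eigenval_nonneg ξ) _
        · exact subset_univ _

end Kernel

section Walk

/-! ### Sums along dyadic windows -/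

/-- The expected number of visits to `u` at the times in `[j, 2 j)`, starting from `x`. -/
noncomputable def windowGreen (n j : ℕ) [NeZero n] (x u : Torus4 n) : ℝ :=
  ∑ i ∈ range j, (stepMatrix n ^ (j + i)) x u

/-- The mean of `windowGreen n j x` at the position of the walk from `x` at time `j`. -/
noncomputable def windowMean (n j : ℕ) [NeZero n] : ℝ :=
  ∑ i ∈ range j, returnProb n (2 * j + i)

/-- The set `E` is determined by the positions `X 0, …, X t`. -/
def DeterminedBy {Ω : Type*} {n : ℕ} (X : ℕ → Ω → Torus4 n) (t : ℕ) (E : Set Ω) : Prop :=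
  ∀ ω ω', (∀ s ≤ t, X s ω = X s ω') → ω ∈ E → ω' ∈ E

lemma determinedBy_eq {Ω : Type*} {n : ℕ} (X : ℕ → Ω → Torus4 n) (t : ℕ) (b : Torus4 n) :
    DeterminedBy X t {ω | X t ω = b} := fun _ _ h hω => (h t le_rfl).symm.trans hω

variable {n : ℕ} [NeZero n]

lemma sum_stepMatrix_pow_mul (a b : ℕ) (x z : Torus4 n) :
    ∑ w, (stepMatrix n ^ a) x w * (stepMatrix n ^ b) z w = (stepMatrix n ^ (a + b)) x z := by
  rw [pow_add, Matrix.mul_apply]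
  exact sum_congr rfl fun w _ => by rw [stepMatrix_pow_comm b]

lemma windowGreen_nonneg (j : ℕ) (x u : Torus4 n) : 0 ≤ windowGreen n j x u :=
  sum_nonneg fun _ _ => stepMatrix_pow_nonneg _ _ _

lemma sum_mul_windowGreen (j : ℕ) (x : Torus4 n) :
    ∑ u, (stepMatrix n ^ j) x u * windowGreen n j x u = windowMean n j := by
  simp_rw [windowGreen, windowMean, mul_sum]
  rw [sum_comm]
  refine sum_congr rfl fun i _ => ?_
  rw [sum_stepMatrix_pow_mul, stepMatrix_pow_diag]
  congr 1
  ring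

/-- Shifting a window by one step loses at most its first term, which is at most `a b`. -/
lemma sum_shift_sub_le {a : ℕ → ℝ} (ha : Antitone a) (h0 : ∀ m, 0 ≤ a m) (b j k : ℕ) :
    ∑ i ∈ range k, a (b + i) - ∑ i ∈ range k, a (b + j + i) ≤ j * a b := by
  induction j with
  | zero => simp
  | succ j ih =>
    have h := sum_range_sub' (fun i => a (b + j + i)) k
    rw [sum_sub_distrib] at h
    have h1 : a (b + j + 0) ≤ a b := ha (by omega)
    have h2 : ∑ i ∈ range k, a (b + (j + 1) + i) = ∑ i ∈ range k, a (b + j + (i + 1)) :=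
      sum_congr rfl fun i _ => by congr 1; ring
    rw [h2]
    push_cast
    linarith [h0 (b + j + k)]

lemma windowMean_le {j : ℕ} (hj : 1 ≤ j) (hjn : j ≤ n ^ 2) : windowMean n j ≤ 625 / j := by
  have hj' : (0 : ℝ) < j := by exact_mod_cast hj
  have h : windowMean n j ≤ ∑ i ∈ range j, 625 / (j : ℝ) ^ 2 :=
    -- The actual times may exceed `n ^ 2`, so monotonicity first lowers them to `j`.
    sum_le_sum fun i _ => (returnProb_antitone (by omega)).trans (returnProb_le hj hjn)
  refine h.trans (le_of_eq ?_)
  rw [sum_const, card_range, nsmul_eq_mul]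
  field_simp

lemma le_windowMean {j : ℕ} (hj : 1 ≤ j) : 1 / (7200 * j) ≤ windowMean n j := by
  have hj' : (0 : ℝ) < j := by exact_mod_cast hj
  have h : ∑ i ∈ range j, 1 / (800 * ((3 * j : ℕ) : ℝ) ^ 2) ≤ windowMean n j :=
    sum_le_sum fun i hi => (le_returnProb (by omega)).trans
      (returnProb_antitone (by have := mem_range.mp hi; omega))
  refine (le_of_eq ?_).trans h
  rw [sum_const, card_range, nsmul_eq_mul]
  push_cast
  field_simp
  norm_num

/-- The covariance bound. Knowing the position at time `j` raises the mean of window `k` by at most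
the cost of shifting that window by `j`, namely `j * 625 / k ^ 2`; the factor `j` cancels against
`windowMean n j ≤ 625 / j`. -/
lemma sum_windowGreen_mul_windowGreen_le {j k : ℕ} (hj : 1 ≤ j) (hjk : j ≤ k) (hk : k ≤ n ^ 2)
    (x : Torus4 n) :
    ∑ u, (stepMatrix n ^ j) x u * windowGreen n j x u *
        ∑ v, (stepMatrix n ^ (k - j)) u v * windowGreen n k x v ≤
      windowMean n j * windowMean n k + 625 ^ 2 / (k : ℝ) ^ 2 := by
  have hj' : (0 : ℝ) < j := by exact_mod_cast hj
  have hk' : (0 : ℝ) < k := by exact_mod_cast hj.trans hjk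
  have hin : ∀ u, ∑ v, (stepMatrix n ^ (k - j)) u v * windowGreen n k x v ≤
      windowMean n k + j * (625 / (k : ℝ) ^ 2) := by
    intro u
    have h1 : ∑ v, (stepMatrix n ^ (k - j)) u v * windowGreen n k x v =
        ∑ i ∈ range k, (stepMatrix n ^ (2 * k - j + i)) u x := by
      simp_rw [windowGreen, mul_sum]
      rw [sum_comm]
      refine sum_congr rfl fun i _ => ?_
      rw [sum_stepMatrix_pow_mul, show k - j + (k + i) = 2 * k - j + i by omega]
    have h2 := sum_shift_sub_le (returnProb_antitone (n := n)) returnProb_nonneg (2 * k - j) j k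
    rw [show 2 * k - j + j = 2 * k by omega] at h2
    have h3 : returnProb n (2 * k - j) ≤ 625 / (k : ℝ) ^ 2 :=
      (returnProb_antitone (by omega)).trans (returnProb_le (hj.trans hjk) hk)
    have h4 := mul_le_mul_of_nonneg_left h3 hj'.le
    rw [h1]
    refine (sum_le_sum fun i _ => stepMatrix_pow_le _ _ _).trans ?_
    rw [windowMean]
    linarith
  calc _ ≤ ∑ u, (stepMatrix n ^ j) x u * windowGreen n j x u *
        (windowMean n k + j * (625 / (k : ℝ) ^ 2)) :=
        sum_le_sum fun u _ => mul_le_mul_of_nonneg_left (hin u)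
          (mul_nonneg (stepMatrix_pow_nonneg _ _ _) (windowGreen_nonneg _ _ _))
    _ = windowMean n j * windowMean n k + windowMean n j * (j * (625 / (k : ℝ) ^ 2)) := by
        rw [← sum_mul, sum_mul_windowGreen, mul_add]
    _ ≤ windowMean n j * windowMean n k + 625 / j * (j * (625 / (k : ℝ) ^ 2)) := by
        gcongr
        exact windowMean_le hj (hjk.trans hk)
    _ = _ := by field_simp

/-! ### The Markov property -/

section Markov

variable {Ω : Type*} [MeasurableSpace Ω] {μ : Measure Ω} {X Y : ℕ → Ω → Torus4 n}

lemma measureReal_eq_sum_inter [IsFiniteMeasure μ] {α : Type*} [Fintype α] [MeasurableSpace α]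
    [MeasurableSingletonClass α] {Z : Ω → α} (hZ : Measurable Z) (A : Set Ω) :
    μ.real A = ∑ z, μ.real (A ∩ {ω | Z ω = z}) := by
  have h := sum_measureReal_preimage_singleton (μ := μ.restrict A) (f := Z) univ
    (fun z _ => hZ (measurableSet_singleton z))
  simp only [coe_univ, Set.preimage_univ, measureReal_restrict_apply_univ] at h
  rw [← h]
  refine sum_congr rfl fun z _ => ?_
  rw [measureReal_restrict_apply (hZ (measurableSet_singleton z)), Set.inter_comm]
  rfl

lemma DeterminedBy.measurableSet (hX : ∀ t, Measurable (X t)) {t : ℕ} {E : Set Ω}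
    (hE : DeterminedBy X t E) : MeasurableSet E := by
  have h : E = (fun ω (s : Fin (t + 1)) => X s ω) ⁻¹'
      ((fun ω (s : Fin (t + 1)) => X s ω) '' E) := by
    refine Set.Subset.antisymm (Set.subset_preimage_image _ _) ?_
    rintro ω ⟨ω', hω', he⟩
    exact hE ω' ω (fun s hs => congrFun he ⟨s, Nat.lt_succ_of_le hs⟩) hω'
  rw [h]
  exact measurable_pi_lambda _ (fun s : Fin (t + 1) => hX s) (Set.toFinite _).measurableSet

/-- Induction on `i`, summing over the position at time `t + 1`; the prescribed path changes in the
process, hence the generalisation over `t` and `x`. -/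
lemma measure_cylinder_inter [IsFiniteMeasure μ] (hX : IsTorusWalk n μ X) (t i : ℕ)
    (x : ℕ → Torus4 n) (z : Torus4 n) :
    μ.real ({ω | ∀ s ≤ t, X s ω = x s} ∩ {ω | X (t + i) ω = z}) =
      μ.real {ω | ∀ s ≤ t, X s ω = x s} * (stepMatrix n ^ i) (x t) z := by
  induction i generalizing t x with
  | zero =>
    rw [pow_zero, Matrix.one_apply]
    split_ifs with h
    · rw [mul_one]
      congr 1
      ext ω
      simp only [Set.mem_inter_iff, Set.mem_ofPred_eq, and_iff_left_iff_imp]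
      intro hω
      rw [← h, ← hω t le_rfl, add_zero]
    · rw [mul_zero]
      convert measureReal_empty
      ext ω
      simp only [Set.mem_inter_iff, Set.mem_ofPred_eq, Set.mem_empty_iff_false, iff_false, not_and]
      intro hω hz
      exact h (by rw [← hz, ← hω t le_rfl, add_zero])
  | succ i ih =>
    rw [measureReal_eq_sum_inter (hX.measurable (t + 1)), pow_succ', Matrix.mul_apply, mul_sum]
    refine sum_congr rfl fun w _ => ?_
    have hx : ∀ s ≤ t, Function.update x (t + 1) w s = x s := fun s hs =>
      Function.update_of_ne (by omega) _ _
    have hcyl : {ω | ∀ s ≤ t, X s ω = Function.update x (t + 1) w s} =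
        {ω | ∀ s ≤ t, X s ω = x s} := by
      ext ω
      exact forall₂_congr fun s hs => by rw [hx s hs]
    have hs := hX.step t (Function.update x (t + 1) w)
    have h := ih (t + 1) (Function.update x (t + 1) w)
    rw [hs, hcyl, hx t le_rfl, Function.update_self] at h
    rw [← mul_assoc]
    refine Eq.trans ?_ h
    congr 1
    ext ω
    have h1 : (∀ s ≤ t + 1, X s ω = Function.update x (t + 1) w s) ↔
        (∀ s ≤ t, X s ω = x s) ∧ X (t + 1) ω = w := by
      constructor
      · intro h
        exact ⟨fun s hs => (h s (by omega)).trans (hx s hs),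
          (h _ le_rfl).trans (Function.update_self _ _ _)⟩
      · rintro ⟨h, h'⟩ s hs
        rcases Nat.lt_or_ge t s with hts | hts
        · obtain rfl : s = t + 1 := by omega
          rw [h', Function.update_self]
        · rw [h s hts, hx s hts]
    simp only [Set.mem_inter_iff, Set.mem_ofPred_eq, h1, show t + 1 + i = t + (i + 1) by ring]
    tauto

/-- The Markov property, for an event determined by the positions up to time `t`. -/
lemma measure_inter_eq_mul [IsFiniteMeasure μ] (hX : IsTorusWalk n μ X) {t : ℕ} {E : Set Ω}
    (hE : DeterminedBy X t E) {b : Torus4 n} (hb : ∀ ω ∈ E, X t ω = b) (i : ℕ) (z : Torus4 n) :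
    μ.real (E ∩ {ω | X (t + i) ω = z}) = μ.real E * (stepMatrix n ^ i) b z := by
  have hm : Measurable (fun ω (s : Fin (t + 1)) => X s ω) :=
    measurable_pi_lambda _ fun s => hX.measurable s
  rw [measureReal_eq_sum_inter hm, measureReal_eq_sum_inter hm E, sum_mul]
  refine sum_congr rfl fun y _ => ?_
  by_cases hne : (E ∩ {ω | (fun s : Fin (t + 1) => X s ω) = y}).Nonempty
  · obtain ⟨ω₀, h₀, h₀'⟩ := hne
    have hy : E ∩ {ω | (fun s : Fin (t + 1) => X s ω) = y} =
        {ω | ∀ s ≤ t, X s ω = X s ω₀} := by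
      ext ω
      constructor
      · rintro ⟨_, hω⟩ s hs
        exact congrFun (hω.trans h₀'.symm) ⟨s, Nat.lt_succ_of_le hs⟩
      · intro hω
        refine ⟨hE ω₀ ω (fun s hs => (hω s hs).symm) h₀, ?_⟩
        rw [Set.mem_ofPred_eq, ← h₀']
        exact funext fun s => hω s (Nat.lt_succ_iff.mp s.2)
    rw [Set.inter_right_comm, hy, measure_cylinder_inter hX t i (fun s => X s ω₀), hb ω₀ h₀]
  · rw [Set.not_nonempty_iff_eq_empty] at hne
    rw [Set.inter_right_comm, hne]
    simp

lemma measureReal_eq_of_uniform [IsProbabilityMeasure μ] (hY : IsTorusWalk n μ Y)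
    (h0 : ∀ y : Torus4 n, μ.real {ω | Y 0 ω = y} = 1 / (n : ℝ) ^ 4) (t : ℕ) (y : Torus4 n) :
    μ.real {ω | Y t ω = y} = 1 / (n : ℝ) ^ 4 := by
  rw [measureReal_eq_sum_inter (hY.measurable 0)]
  have h : ∀ z, μ.real ({ω | Y t ω = y} ∩ {ω | Y 0 ω = z}) =
      1 / (n : ℝ) ^ 4 * (stepMatrix n ^ t) y z := by
    intro z
    have := measure_inter_eq_mul hY (determinedBy_eq Y 0 z) (fun _ h => h) t y
    rw [zero_add, h0, stepMatrix_pow_comm] at this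
    rw [Set.inter_comm, this]
  simp_rw [h, ← mul_sum, sum_stepMatrix_pow, mul_one]

/-- A first-passage bound: if every point of `B` leads to at least `c` expected visits, weighted
by `V`, during the next `R` steps, then hitting `B` costs at least `c` in expectation. -/
lemma mul_measure_hit_le [IsProbabilityMeasure μ] (hX : IsTorusWalk n μ X) (B : Set (Torus4 n))
    (V : Torus4 n → ℝ) (hV : ∀ z, 0 ≤ V z) (c : ℝ) (K R : ℕ)
    (hc : ∀ b ∈ B, c ≤ ∑ i ∈ range R, ∑ z, (stepMatrix n ^ i) b z * V z) :
    c * μ.real {ω | ∃ s ≤ K, X s ω ∈ B} ≤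
      ∑ s ∈ range (K + R), ∑ z, μ.real {ω | X s ω = z} * V z := by
  classical
  -- First entrance into `B` at time `s` and point `b`. These events are disjoint and determined by
  -- the past, so visits counted from each of them are not counted twice.
  set F : ℕ → Torus4 n → Set Ω := fun s b => {ω | (∀ r < s, X r ω ∉ B) ∧ X s ω = b ∧ b ∈ B} with hF
  have hdet : ∀ s b, DeterminedBy X s (F s b) := by
    rintro s b ω ω' h ⟨h1, h2, h3⟩
    exact ⟨fun r hr => h r hr.le ▸ h1 r hr, (h s le_rfl).symm.trans h2, h3⟩
  have hmeas : ∀ s b, MeasurableSet (F s b) := fun s b => (hdet s b).measurableSet hX.measurable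
  have hdisj : ∀ p q : ℕ × Torus4 n, p ≠ q → Disjoint (F p.1 p.2) (F q.1 q.2) := by
    rintro ⟨s, b⟩ ⟨s', b'⟩ hne
    rw [Set.disjoint_left]
    rintro ω ⟨h1, h2, h3⟩ ⟨h1', h2', h3'⟩
    simp only at h1 h2 h3 h1' h2' h3'
    rcases lt_trichotomy s s' with h | rfl | h
    · exact h1' s h (h2 ▸ h3)
    · exact hne (by rw [← h2, ← h2'])
    · exact h1 s' h (h2' ▸ h3')
  have hcover : {ω | ∃ s ≤ K, X s ω ∈ B} ⊆ ⋃ p ∈ range (K + 1) ×ˢ (univ : Finset (Torus4 n)),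
      F p.1 p.2 := by
    rintro ω ⟨s, hs, hω⟩
    have hex : ∃ s, X s ω ∈ B := ⟨s, hω⟩
    simp only [Set.mem_iUnion]
    refine ⟨(Nat.find hex, X (Nat.find hex) ω), ?_, fun r hr => Nat.find_min hex hr, rfl,
      Nat.find_spec hex⟩
    have := Nat.find_min' hex hω
    simp only [mem_product, mem_range, mem_univ, and_true]
    omega
  have hvisit : ∀ s b, c * μ.real (F s b) ≤
      ∑ i ∈ range R, ∑ z, μ.real (F s b ∩ {ω | X (s + i) ω = z}) * V z := by
    intro s b
    by_cases hb : b ∈ B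
    · have h := mul_le_mul_of_nonneg_right (hc b hb) (measureReal_nonneg (μ := μ) (s := F s b))
      refine h.trans (le_of_eq ?_)
      rw [sum_mul]
      refine sum_congr rfl fun i _ => ?_
      rw [sum_mul]
      refine sum_congr rfl fun z _ => ?_
      rw [measure_inter_eq_mul hX (hdet s b) (fun ω h => h.2.1)]
      ring
    · have : F s b = ∅ := by
        ext ω
        simp [hF, hb]
      simp [this]
  have hsplit : ∀ t z, ∑ p ∈ range (K + 1) ×ˢ (univ : Finset (Torus4 n)),
      μ.real (F p.1 p.2 ∩ {ω | X t ω = z}) ≤ μ.real {ω | X t ω = z} := by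
    intro t z
    rw [← measureReal_biUnion_finset]
    · exact measureReal_mono (Set.iUnion₂_subset fun p _ => Set.inter_subset_right)
    · exact fun p _ q _ hpq => (hdisj p q hpq).mono Set.inter_subset_left Set.inter_subset_left
    · exact fun p _ => (hmeas _ _).inter (hX.measurable t (measurableSet_singleton z))
  have hc0 : c * μ.real {ω | ∃ s ≤ K, X s ω ∈ B} ≤
      ∑ p ∈ range (K + 1) ×ˢ (univ : Finset (Torus4 n)), c * μ.real (F p.1 p.2) := by
    rw [← mul_sum, ← measureReal_biUnion_finset (fun p _ q _ hpq => hdisj p q hpq)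
      (fun p _ => hmeas _ _)]
    refine le_of_eq ?_
    congr 2
    refine hcover.antisymm ?_
    refine Set.iUnion₂_subset fun p hp => ?_
    rintro ω ⟨_, h2, h3⟩
    exact ⟨p.1, by have := (mem_product.mp hp).1; rw [mem_range] at this; omega, h2 ▸ h3⟩
  calc _ ≤ _ := hc0
    _ ≤ ∑ p ∈ range (K + 1) ×ˢ (univ : Finset (Torus4 n)),
        ∑ t ∈ range (K + R), ∑ z, μ.real (F p.1 p.2 ∩ {ω | X t ω = z}) * V z := by
      refine sum_le_sum fun p hp => (hvisit p.1 p.2).trans ?_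
      have hinj : Function.Injective (fun i : ℕ => p.1 + i) := add_right_injective _
      rw [← sum_image (s := range R) (g := fun i => p.1 + i)
        (f := fun t => ∑ z, μ.real (F p.1 p.2 ∩ {ω | X t ω = z}) * V z) hinj.injOn]
      refine sum_le_sum_of_subset_of_nonneg ?_ fun t _ _ =>
        sum_nonneg fun z _ => mul_nonneg measureReal_nonneg (hV z)
      intro t ht
      obtain ⟨i, hi, rfl⟩ := mem_image.mp ht
      have := (mem_product.mp hp).1
      rw [mem_range] at *
      omega
    _ = ∑ t ∈ range (K + R), ∑ z, (∑ p ∈ range (K + 1) ×ˢ (univ : Finset (Torus4 n)),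
        μ.real (F p.1 p.2 ∩ {ω | X t ω = z})) * V z := by
      rw [sum_comm]
      refine sum_congr rfl fun t _ => ?_
      rw [sum_comm]
      simp_rw [sum_mul]
    _ ≤ _ := by
      gcongr with t _ z _
      · exact hV z
      · exact hsplit t z

end Markov

end Walk

section Score

/-! ### The second moment of the local score -/

/-- The expected number of visits, in the dyadic windows, to the positions `y (t + 1), …, y (t + T)`
of a walk that starts from `y t`. -/
noncomputable def score (n T : ℕ) [NeZero n] (t : ℕ) (y : ℕ → Torus4 n) : ℝ :=
  ∑ j ∈ range T, windowGreen n (j + 1) (y t) (y (t + (j + 1)))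

/-- The mean of the local score of a random walk. -/
noncomputable def meanScore (n T : ℕ) [NeZero n] : ℝ := ∑ j ∈ range T, windowMean n (j + 1)

/-- Exactly `2 T + 1` index pairs have maximum `T`, and each contributes `1 / (T + 1) ^ 2`. -/
lemma sum_inv_max_sq_le (T : ℕ) :
    ∑ j ∈ range T, ∑ k ∈ range T, 1 / (((max j k : ℕ) : ℝ) + 1) ^ 2 ≤
      2 * ∑ k ∈ range T, 1 / ((k : ℝ) + 1) := by
  induction T with
  | zero => simp
  | succ T ih =>
    simp_rw [sum_range_succ, sum_add_distrib]
    have h1 : ∑ j ∈ range T, 1 / (((max j T : ℕ) : ℝ) + 1) ^ 2 = T * (1 / ((T : ℝ) + 1) ^ 2) := by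
      rw [sum_congr rfl fun j hj => by rw [max_eq_right (mem_range.mp hj).le], sum_const,
        card_range, nsmul_eq_mul]
    have h2 : ∑ k ∈ range T, 1 / (((max T k : ℕ) : ℝ) + 1) ^ 2 = T * (1 / ((T : ℝ) + 1) ^ 2) := by
      simp_rw [max_comm T]
      exact h1
    rw [h1, h2, max_self]
    have h3 : T * (1 / ((T : ℝ) + 1) ^ 2) + (T * (1 / ((T : ℝ) + 1) ^ 2) + 1 / ((T : ℝ) + 1) ^ 2) ≤
        2 * (1 / ((T : ℝ) + 1)) := by
      have h4 : 2 * (1 / ((T : ℝ) + 1)) = (2 * (T + 1)) * (1 / ((T : ℝ) + 1) ^ 2) := by field_simp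
      rw [h4]
      have : (0 : ℝ) < 1 / ((T : ℝ) + 1) ^ 2 := by positivity
      linarith
    linarith

variable {n : ℕ} [NeZero n]

lemma le_meanScore (T : ℕ) : (∑ k ∈ range T, 1 / ((k : ℝ) + 1)) / 7200 ≤ meanScore n T := by
  rw [sum_div]
  refine sum_le_sum fun k _ => ?_
  have h := le_windowMean (n := n) (Nat.succ_pos k)
  rw [div_div, mul_comm]
  exact_mod_cast h

lemma determinedBy_score (T t : ℕ) (x : Torus4 n) (c : ℝ) :
    DeterminedBy (fun t (y : ℕ → Torus4 n) => y t) (t + T) {y | y t = x ∧ score n T t y < c} := by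
  rintro y y' h ⟨h1, h2⟩
  replace h : ∀ s ≤ t + T, y s = y' s := h
  have hs : score n T t y = score n T t y' := by
    refine sum_congr rfl fun j hj => ?_
    have := mem_range.mp hj
    rw [h t (by omega), h (t + (j + 1)) (by omega)]
  exact ⟨(h t (by omega)).symm.trans h1, hs ▸ h2⟩

section Moments

variable {Ω : Type*} [MeasurableSpace Ω] {μ : Measure Ω} {X Y : ℕ → Ω → Torus4 n}

lemma integrable_comp_finite [IsFiniteMeasure μ] {α : Type*} [Finite α] [MeasurableSpace α]
    [MeasurableSingletonClass α] {Z : Ω → α} (hZ : Measurable Z) (F : α → ℝ) :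
    Integrable (fun ω => F (Z ω)) μ :=
  (Integrable.of_finite (μ := μ.map Z) (f := F)).comp_measurable hZ

lemma setIntegral_comp_eq_sum [IsFiniteMeasure μ] {α : Type*} [Fintype α] [MeasurableSpace α]
    [MeasurableSingletonClass α] {Z : Ω → α} (hZ : Measurable Z) (F : α → ℝ) (E : Set Ω) :
    ∫ ω in E, F (Z ω) ∂μ = ∑ z, μ.real (E ∩ {ω | Z ω = z}) * F z := by
  have h := integral_map (μ := μ.restrict E) hZ.aemeasurable
    (Measurable.of_discrete (f := F)).aestronglyMeasurable
  rw [← h, integral_fintype Integrable.of_finite]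
  refine sum_congr rfl fun z _ => ?_
  rw [map_measureReal_apply hZ (measurableSet_singleton z),
    measureReal_restrict_apply (hZ (measurableSet_singleton z)), Set.inter_comm, smul_eq_mul]
  rfl

lemma setIntegral_windowGreen [IsFiniteMeasure μ] (hY : IsTorusWalk n μ Y) (t j : ℕ)
    (x : Torus4 n) :
    ∫ ω in {ω | Y t ω = x}, windowGreen n j x (Y (t + j) ω) ∂μ =
      μ.real {ω | Y t ω = x} * windowMean n j := by
  rw [setIntegral_comp_eq_sum (hY.measurable _), ← sum_mul_windowGreen j x, mul_sum]
  refine sum_congr rfl fun u _ => ?_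
  rw [measure_inter_eq_mul hY (determinedBy_eq Y t x) (fun _ h => h), mul_assoc]

lemma setIntegral_windowGreen_mul_le [IsFiniteMeasure μ] (hY : IsTorusWalk n μ Y) (t : ℕ)
    {j k : ℕ} (hj : 1 ≤ j) (hjk : j ≤ k) (hk : k ≤ n ^ 2) (x : Torus4 n) :
    ∫ ω in {ω | Y t ω = x},
        windowGreen n j x (Y (t + j) ω) * windowGreen n k x (Y (t + k) ω) ∂μ ≤
      μ.real {ω | Y t ω = x} * (windowMean n j * windowMean n k + 625 ^ 2 / (k : ℝ) ^ 2) := by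
  have h := setIntegral_comp_eq_sum (μ := μ) ((hY.measurable (t + j)).prodMk (hY.measurable (t + k)))
    (fun p => windowGreen n j x p.1 * windowGreen n k x p.2) {ω | Y t ω = x}
  rw [h]
  refine le_trans (le_of_eq ?_) (mul_le_mul_of_nonneg_left
    (sum_windowGreen_mul_windowGreen_le hj hjk hk x) measureReal_nonneg)
  rw [Fintype.sum_prod_type, mul_sum]
  refine sum_congr rfl fun u _ => ?_
  rw [mul_sum, mul_sum]
  refine sum_congr rfl fun v _ => ?_
  have hdet : DeterminedBy Y (t + j) ({ω | Y t ω = x} ∩ {ω | Y (t + j) ω = u}) := by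
    rintro ω ω' h ⟨h1, h2⟩
    exact ⟨(h t (by omega)).symm.trans h1, (h _ le_rfl).symm.trans h2⟩
  have h1 := measure_inter_eq_mul hY hdet (fun _ h => h.2) (k - j) v
  rw [measure_inter_eq_mul hY (determinedBy_eq Y t x) (fun _ h => h),
    show t + j + (k - j) = t + k by omega] at h1
  have h2 : {ω | Y t ω = x} ∩ {ω | (Y (t + j) ω, Y (t + k) ω) = (u, v)} =
      {ω | Y t ω = x} ∩ {ω | Y (t + j) ω = u} ∩ {ω | Y (t + k) ω = v} := by
    ext ω
    simp [and_assoc]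
  rw [h2, h1]
  ring

/-- The square expands into covariances, each at most of order `1 / max j k ^ 2`, so the variance
grows like the harmonic sum rather than its square. -/
lemma setIntegral_score_sub_sq_le [IsFiniteMeasure μ] (hY : IsTorusWalk n μ Y) (t T : ℕ)
    (hT : T ≤ n ^ 2) (x : Torus4 n) :
    ∫ ω in {ω | Y t ω = x}, (∑ j ∈ range T, windowGreen n (j + 1) x (Y (t + (j + 1)) ω) -
        meanScore n T) ^ 2 ∂μ ≤
      μ.real {ω | Y t ω = x} * (2 * 625 ^ 2 * ∑ k ∈ range T, 1 / ((k : ℝ) + 1)) := by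
  set E : Set Ω := {ω | Y t ω = x} with hE
  set f : ℕ → Ω → ℝ := fun j ω => windowGreen n (j + 1) x (Y (t + (j + 1)) ω) with hf
  set m : ℕ → ℝ := fun j => windowMean n (j + 1) with hm
  have hint : ∀ j, Integrable (f j) (μ.restrict E) := fun j =>
    integrable_comp_finite (hY.measurable _) _
  have hint2 : ∀ j k, Integrable (fun ω => f j ω * f k ω) (μ.restrict E) := fun j k =>
    integrable_comp_finite (((hY.measurable (t + (j + 1))).prodMk (hY.measurable (t + (k + 1)))))
      (fun p => windowGreen n (j + 1) x p.1 * windowGreen n (k + 1) x p.2)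
  have hmean : ∀ j, ∫ ω in E, f j ω ∂μ = μ.real E * m j := fun j =>
    setIntegral_windowGreen hY t (j + 1) x
  have hterm : ∀ j k, (f j · - m j) * (f k · - m k) = fun ω =>
      f j ω * f k ω - m k * f j ω - m j * f k ω + m j * m k := by
    intro j k
    funext ω
    simp only [Pi.mul_apply]
    ring
  have hint3 : ∀ j k, Integrable ((f j · - m j) * (f k · - m k)) (μ.restrict E) := by
    intro j k
    rw [hterm]
    exact (((hint2 j k).sub ((hint j).const_mul _)).sub ((hint k).const_mul _)).add
      (integrable_const _)
  have hcov : ∀ j k, ∫ ω in E, ((f j · - m j) * (f k · - m k)) ω ∂μ =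
      ∫ ω in E, f j ω * f k ω ∂μ - μ.real E * (m j * m k) := by
    intro j k
    have i1 : Integrable (fun ω => m k * f j ω) (μ.restrict E) := (hint j).const_mul _
    have i2 : Integrable (fun ω => m j * f k ω) (μ.restrict E) := (hint k).const_mul _
    have i3 : Integrable (fun ω => f j ω * f k ω - m k * f j ω) (μ.restrict E) := (hint2 j k).sub i1
    have i4 : Integrable (fun ω => f j ω * f k ω - m k * f j ω - m j * f k ω) (μ.restrict E) :=
      i3.sub i2
    rw [hterm, integral_add i4 (integrable_const _), integral_sub i3 i2, integral_sub (hint2 j k) i1,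
      integral_const_mul, integral_const_mul, hmean, hmean, integral_const, smul_eq_mul,
      measureReal_restrict_apply_univ]
    ring
  have hle : ∀ j k, j < T → k < T → j ≤ k → ∫ ω in E, f j ω * f k ω ∂μ - μ.real E * (m j * m k) ≤
      μ.real E * (625 ^ 2 * (1 / ((k : ℝ) + 1) ^ 2)) := by
    intro j k _ hk hjk
    have h := setIntegral_windowGreen_mul_le hY t (Nat.succ_pos j) (Nat.succ_le_succ hjk)
      (show k + 1 ≤ n ^ 2 by omega) x
    rw [mul_add] at h
    push_cast at h
    rw [mul_one_div]
    linarith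
  have hle' : ∀ j k, j < T → k < T → ∫ ω in E, f j ω * f k ω ∂μ - μ.real E * (m j * m k) ≤
      μ.real E * (625 ^ 2 * (1 / (((max j k : ℕ) : ℝ) + 1) ^ 2)) := by
    intro j k hj hk
    rcases le_total j k with h | h
    · rw [max_eq_right h]
      exact hle j k hj hk h
    · rw [max_eq_left h]
      simp_rw [mul_comm (f j _), mul_comm (m j)]
      exact hle k j hk hj h
  have hsq : ∀ ω, (∑ j ∈ range T, f j ω - meanScore n T) ^ 2 =
      ∑ j ∈ range T, ∑ k ∈ range T, ((f j · - m j) * (f k · - m k)) ω := by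
    intro ω
    rw [meanScore, ← sum_sub_distrib, sq, sum_mul_sum]
    rfl
  calc ∫ ω in E, (∑ j ∈ range T, f j ω - meanScore n T) ^ 2 ∂μ
      = ∑ j ∈ range T, ∑ k ∈ range T, (∫ ω in E, f j ω * f k ω ∂μ - μ.real E * (m j * m k)) := by
        simp_rw [hsq]
        rw [integral_finsetSum _ fun j _ => integrable_finsetSum _ fun k _ => hint3 j k]
        refine sum_congr rfl fun j _ => ?_
        rw [integral_finsetSum _ fun k _ => hint3 j k]
        exact sum_congr rfl fun k _ => hcov j k
    _ ≤ ∑ j ∈ range T, ∑ k ∈ range T,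
        μ.real E * (625 ^ 2 * (1 / (((max j k : ℕ) : ℝ) + 1) ^ 2)) :=
        sum_le_sum fun j hj => sum_le_sum fun k hk => hle' j k (mem_range.mp hj) (mem_range.mp hk)
    _ ≤ _ := by
        simp_rw [← mul_sum]
        have := sum_inv_max_sq_le T
        refine mul_le_mul_of_nonneg_left ?_ measureReal_nonneg
        linarith

/-- A low local score is unlikely, by Chebyshev's inequality. -/
lemma measure_low_score_le [IsFiniteMeasure μ] (hY : IsTorusWalk n μ Y) {t T : ℕ} (hT1 : 1 ≤ T)
    (hT : T ≤ n ^ 2) (x : Torus4 n) :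
    μ.real {ω | Y t ω = x ∧ score n T t (fun s => Y s ω) < meanScore n T / 2} ≤
      μ.real {ω | Y t ω = x} *
        (8 * 625 ^ 2 * 7200 ^ 2 / ∑ k ∈ range T, 1 / ((k : ℝ) + 1)) := by
  set H : ℝ := ∑ k ∈ range T, 1 / ((k : ℝ) + 1) with hH
  have hHpos : 0 < H := sum_pos (fun k _ => by positivity) ⟨0, mem_range.mpr hT1⟩
  have hM : H / 7200 ≤ meanScore n T := le_meanScore T
  have hMpos : 0 < meanScore n T := lt_of_lt_of_le (by positivity) hM
  set E : Set Ω := {ω | Y t ω = x} with hE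
  set g : Ω → ℝ := fun ω => (∑ j ∈ range T, windowGreen n (j + 1) x (Y (t + (j + 1)) ω) -
    meanScore n T) ^ 2 with hg
  have hgi : Integrable g (μ.restrict E) := by
    -- Integrability is free: `g` factors through finitely many positions in a finite set.
    have hZ : Measurable fun ω => fun j : Fin (T + 1) => Y (t + j) ω :=
      measurable_pi_lambda _ fun j => hY.measurable _
    have h := integrable_comp_finite (μ := μ.restrict E) hZ (fun w => (∑ j : Fin T,
      windowGreen n (j + 1) x (w j.succ) - meanScore n T) ^ 2)
    refine h.congr (Filter.Eventually.of_forall fun ω => ?_)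
    simp only [hg, Fin.val_succ]
    rw [← Fin.sum_univ_eq_sum_range (fun j => windowGreen n (j + 1) x (Y (t + (j + 1)) ω)) T]
  have hEm : MeasurableSet E := hY.measurable t (measurableSet_singleton x)
  have hch := mul_meas_ge_le_integral_of_nonneg (μ := μ.restrict E) (f := g)
    (Filter.Eventually.of_forall fun ω => sq_nonneg _) hgi ((meanScore n T / 2) ^ 2)
  have hsub : μ.real {ω | Y t ω = x ∧ score n T t (fun s => Y s ω) < meanScore n T / 2} ≤
      (μ.restrict E).real {ω | (meanScore n T / 2) ^ 2 ≤ g ω} := by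
    rw [measureReal_restrict_apply' hEm]
    refine measureReal_mono ?_
    rintro ω ⟨h1, h2⟩
    refine ⟨?_, h1⟩
    have h3 : ∑ j ∈ range T, windowGreen n (j + 1) x (Y (t + (j + 1)) ω) < meanScore n T / 2 := by
      rw [score, h1] at h2
      exact h2
    change (meanScore n T / 2) ^ 2 ≤ (_ - meanScore n T) ^ 2
    nlinarith
  have h1 : (meanScore n T / 2) ^ 2 *
      μ.real {ω | Y t ω = x ∧ score n T t (fun s => Y s ω) < meanScore n T / 2} ≤
        μ.real E * (2 * 625 ^ 2 * H) :=
    (mul_le_mul_of_nonneg_left hsub (sq_nonneg _)).trans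
      (hch.trans (setIntegral_score_sub_sq_le hY t T hT x))
  have h2 : (H / 7200 / 2) ^ 2 ≤ (meanScore n T / 2) ^ 2 := by gcongr
  have h3 := (mul_le_mul_of_nonneg_right h2 measureReal_nonneg).trans h1
  have h4 : μ.real E * (8 * 625 ^ 2 * 7200 ^ 2 / H) =
      μ.real E * (2 * 625 ^ 2 * H) / (H / 7200 / 2) ^ 2 := by
    field_simp
    norm_num
  rw [h4, le_div_iff₀ (by positivity), mul_comm]
  exact h3

end Moments

end Score

/-! ### Two independent walks -/

section Pair

variable {n : ℕ} [NeZero n] {Ω : Type*} [MeasurableSpace Ω] {μ : Measure Ω}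
  {X Y : ℕ → Ω → Torus4 n}

lemma measureReal_inter_eq_mul
    (hind : IndepFun (fun ω t => X t ω) (fun ω t => Y t ω) μ) {N M : ℕ} {A B : Set (ℕ → Torus4 n)}
    (hA : DeterminedBy (fun t (y : ℕ → Torus4 n) => y t) N A)
    (hB : DeterminedBy (fun t (y : ℕ → Torus4 n) => y t) M B) :
    μ.real ({ω | (fun t => X t ω) ∈ A} ∩ {ω | (fun t => Y t ω) ∈ B}) =
      μ.real {ω | (fun t => X t ω) ∈ A} * μ.real {ω | (fun t => Y t ω) ∈ B} := by
  have h := hind.measure_inter_preimage_eq_mul A B (hA.measurableSet measurable_pi_apply)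
    (hB.measurableSet measurable_pi_apply)
  simp only [measureReal_def, ← ENNReal.toReal_mul]
  exact congrArg ENNReal.toReal h

lemma sum_measureReal_eq_one [IsProbabilityMeasure μ] (hX : IsTorusWalk n μ X) (s : ℕ) :
    ∑ z, μ.real {ω | X s ω = z} = 1 := by
  have h := measureReal_eq_sum_inter (μ := μ) (hX.measurable s) Set.univ
  simp only [Set.univ_inter, probReal_univ] at h
  exact h.symm

/-- By independence, a bound on the `Y`-event uniform in the target point survives averaging over
the law of `X s`, whatever that law is. -/
lemma measureReal_meet_inter_le [IsProbabilityMeasure μ] (hX : IsTorusWalk n μ X)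
    (hind : IndepFun (fun ω t => X t ω) (fun ω t => Y t ω) μ) (s N : ℕ) (δ : ℝ)
    (B : Torus4 n → Set (ℕ → Torus4 n))
    (hB : ∀ z, DeterminedBy (fun t (y : ℕ → Torus4 n) => y t) N (B z))
    (hδ : ∀ z, μ.real {ω | (fun t => Y t ω) ∈ B z} ≤ δ) :
    μ.real {ω | (fun t => Y t ω) ∈ B (X s ω)} ≤ δ := by
  rw [measureReal_eq_sum_inter (hX.measurable s)]
  have h : ∀ z, μ.real ({ω | (fun t => Y t ω) ∈ B (X s ω)} ∩ {ω | X s ω = z}) ≤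
      μ.real {ω | X s ω = z} * δ := by
    intro z
    have h1 := measureReal_inter_eq_mul hind
      (determinedBy_eq (fun t (y : ℕ → Torus4 n) => y t) s z) (hB z)
    have h2 : {ω | (fun t => Y t ω) ∈ B (X s ω)} ∩ {ω | X s ω = z} =
        {ω | (fun t => X t ω) ∈ {y : ℕ → Torus4 n | y s = z}} ∩ {ω | (fun t => Y t ω) ∈ B z} := by
      ext ω
      simp only [Set.mem_inter_iff, Set.mem_ofPred_eq]
      constructor
      · rintro ⟨h, rfl⟩
        exact ⟨rfl, h⟩
      · rintro ⟨rfl, h⟩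
        exact ⟨h, rfl⟩
    rw [h2, h1]
    exact mul_le_mul_of_nonneg_left (hδ z) measureReal_nonneg
  refine (sum_le_sum fun z _ => h z).trans (le_of_eq ?_)
  rw [← sum_mul, sum_measureReal_eq_one hX, one_mul]

lemma sum_range_le_sum_range {f : ℕ → ℝ} (hf : ∀ i, 0 ≤ f i) {a b c : ℕ} (h : a + b ≤ c) :
    ∑ i ∈ range b, f (a + i) ≤ ∑ i ∈ range c, f i := by
  calc ∑ i ∈ range b, f (a + i) ≤ ∑ i ∈ range (a + b), f i := by
        rw [sum_range_add]
        exact le_add_of_nonneg_left (sum_nonneg fun i _ => hf i)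
    _ ≤ _ := sum_le_sum_of_subset_of_nonneg (range_mono h) fun i _ _ => hf i

/-- All windows lie in `[0, 2 T)` and all path times used are at most `L + T`, so the score is
dominated by a full count of coincidences over ranges that do not depend on `t`. -/
lemma score_le (T L t : ℕ) (ht : t ≤ L) (y : ℕ → Torus4 n) :
    score n T t y ≤ ∑ i ∈ range (2 * T), ∑ r ∈ range (L + T + 1), (stepMatrix n ^ i) (y t) (y r) := by
  rw [sum_comm]
  have h1 : ∀ j ∈ range T, windowGreen n (j + 1) (y t) (y (t + (j + 1))) ≤
      ∑ i ∈ range (2 * T), (stepMatrix n ^ i) (y t) (y (t + 1 + j)) := by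
    intro j hj
    have := mem_range.mp hj
    rw [show t + 1 + j = t + (j + 1) by ring]
    exact sum_range_le_sum_range (f := fun i => (stepMatrix n ^ i) (y t) (y (t + (j + 1))))
      (fun i => stepMatrix_pow_nonneg _ _ _) (by omega)
  refine (sum_le_sum h1).trans ?_
  exact sum_range_le_sum_range
    (f := fun r => ∑ i ∈ range (2 * T), (stepMatrix n ^ i) (y t) (y r))
    (fun r => sum_nonneg fun i _ => stepMatrix_pow_nonneg _ _ _) (by omega)

/-- A walk rarely hits the points of a fixed path with a high local score. -/
lemma mul_measure_hit_path_le [IsProbabilityMeasure μ] (hX : IsTorusWalk n μ X) (T K L : ℕ) (c : ℝ)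
    (y : ℕ → Torus4 n) :
    c * μ.real {ω | ∃ s ≤ K, X s ω ∈ {b | ∃ t ≤ L, y t = b ∧ c ≤ score n T t y}} ≤
      ∑ s ∈ range (K + 2 * T), ∑ r ∈ range (L + T + 1), μ.real {ω | X s ω = y r} := by
  classical
  have hsum : ∀ f : Torus4 n → ℝ, ∑ z, f z * ∑ r ∈ range (L + T + 1), (if y r = z then 1 else 0) =
      ∑ r ∈ range (L + T + 1), f (y r) := by
    intro f
    simp_rw [mul_sum]
    rw [sum_comm]
    simp
  have h := mul_measure_hit_le hX {b | ∃ t ≤ L, y t = b ∧ c ≤ score n T t y}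
    (fun z => ∑ r ∈ range (L + T + 1), (if y r = z then 1 else 0))
    (fun z => sum_nonneg fun r _ => by split_ifs <;> norm_num) c K (2 * T) ?_
  · simpa only [hsum] using h
  · rintro b ⟨t, ht, rfl, hc⟩
    simp_rw [hsum]
    exact hc.trans (score_le T L t ht y)

/-- The path of `Y` up to time `L + T` takes finitely many values. On each of them the fixed-path
bound applies to `X` by independence, and summing over paths turns its right side into the expected
number of coincidences. -/
lemma mul_measure_hit_high_score_le [IsProbabilityMeasure μ] (hX : IsTorusWalk n μ X)
    (hY : IsTorusWalk n μ Y) (hind : IndepFun (fun ω t => X t ω) (fun ω t => Y t ω) μ)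
    (h0 : ∀ y : Torus4 n, μ.real {ω | Y 0 ω = y} = 1 / (n : ℝ) ^ 4) (T K L : ℕ) (c : ℝ)
    (hc0 : 0 ≤ c) :
    c * μ.real {ω | ∃ s ≤ K, ∃ t ≤ L, X s ω = Y t ω ∧ c ≤ score n T t (fun r => Y r ω)} ≤
      ((K + 2 * T : ℕ) : ℝ) * ((L + T + 1 : ℕ) : ℝ) * (1 / (n : ℝ) ^ 4) := by
  set Z : Ω → (Fin (L + T + 1) → Torus4 n) := fun ω r => Y r ω with hZdef
  have hZ : Measurable Z := measurable_pi_lambda _ fun r => hY.measurable r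
  have hmeet : ∀ s r, μ.real {ω | X s ω = Y r ω} ≤ 1 / (n : ℝ) ^ 4 := by
    intro s r
    have h := measureReal_meet_inter_le hX hind s r (1 / (n : ℝ) ^ 4) (fun z => {y | y r = z})
      (fun z => determinedBy_eq _ r z) (fun z => (measureReal_eq_of_uniform hY h0 r z).le)
    simpa only [Set.mem_ofPred_eq, eq_comm] using h
  have hfiber : ∀ w, c * μ.real ({ω | ∃ s ≤ K, ∃ t ≤ L, X s ω = Y t ω ∧
      c ≤ score n T t (fun r => Y r ω)} ∩ {ω | Z ω = w}) ≤
      ∑ s ∈ range (K + 2 * T), ∑ r ∈ range (L + T + 1),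
        μ.real ({ω | X s ω = Y r ω} ∩ {ω | Z ω = w}) := by
    intro w
    rcases Set.eq_empty_or_nonempty {ω | Z ω = w} with he | ⟨ω₀, hω₀⟩
    · simp [he]
    set y : ℕ → Torus4 n := fun r => Y r ω₀ with hy
    have hyw : ∀ ω, Z ω = w → ∀ r ≤ L + T, Y r ω = y r := fun ω hω r hr =>
      congrFun (hω.trans hω₀.symm) ⟨r, Nat.lt_succ_of_le hr⟩
    set D : Set (ℕ → Torus4 n) := {x | ∀ r : Fin (L + T + 1), x r = w r} with hD
    have hDdet : DeterminedBy (fun t (y : ℕ → Torus4 n) => y t) (L + T) D := by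
      intro x x' h hx r
      exact (h r (Nat.lt_succ_iff.mp r.2)).symm.trans (hx r)
    have hDZ : {ω | Z ω = w} = {ω | (fun t => Y t ω) ∈ D} := by
      ext ω
      exact funext_iff
    set Bset : Set (Torus4 n) := {b | ∃ t ≤ L, y t = b ∧ c ≤ score n T t y} with hB
    have hAdet : DeterminedBy (fun t (y : ℕ → Torus4 n) => y t) K {x | ∃ s ≤ K, x s ∈ Bset} := by
      rintro x x' h ⟨s, hs, hx⟩
      replace h : ∀ s ≤ K, x s = x' s := h
      exact ⟨s, hs, h s hs ▸ hx⟩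
    have hsub : {ω | ∃ s ≤ K, ∃ t ≤ L, X s ω = Y t ω ∧ c ≤ score n T t (fun r => Y r ω)} ∩
        {ω | Z ω = w} ⊆ {ω | (fun t => X t ω) ∈ {x : ℕ → Torus4 n | ∃ s ≤ K, x s ∈ Bset}} ∩
          {ω | (fun t => Y t ω) ∈ D} := by
      rintro ω ⟨⟨s, hs, t, ht, hst, hsc⟩, hω⟩
      refine ⟨⟨s, hs, t, ht, ?_, ?_⟩, hDZ ▸ hω⟩
      · rw [← hyw ω hω t (by omega)]
        exact hst.symm
      · have : score n T t (fun r => Y r ω) = score n T t y := by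
          refine sum_congr rfl fun j hj => ?_
          have := mem_range.mp hj
          simp only [hyw ω hω t (by omega), hyw ω hω (t + (j + 1)) (by omega)]
        exact this ▸ hsc
    have hpath := mul_measure_hit_path_le hX T K L c y
    calc _ ≤ c * (μ.real {ω | ∃ s ≤ K, X s ω ∈ Bset} * μ.real {ω | Z ω = w}) := by
          rw [hDZ]
          refine mul_le_mul_of_nonneg_left ((measureReal_mono (hDZ ▸ hsub)).trans (le_of_eq ?_)) hc0
          exact measureReal_inter_eq_mul hind hAdet hDdet
      _ ≤ (∑ s ∈ range (K + 2 * T), ∑ r ∈ range (L + T + 1), μ.real {ω | X s ω = y r}) *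
          μ.real {ω | Z ω = w} := by
          rw [← mul_assoc]
          exact mul_le_mul_of_nonneg_right hpath measureReal_nonneg
      _ = _ := by
          simp_rw [sum_mul]
          refine sum_congr rfl fun s _ => sum_congr rfl fun r hr => ?_
          have h1 := measureReal_inter_eq_mul hind
            (determinedBy_eq (fun t (y : ℕ → Torus4 n) => y t) s (y r)) hDdet
          rw [hDZ]
          refine h1.symm.trans ?_
          congr 1
          rw [← hDZ]
          ext ω
          refine and_congr_left fun hω => ?_
          change X s ω = y r ↔ X s ω = Y r ω
          rw [hyw ω hω r (Nat.lt_succ_iff.mp (mem_range.mp hr))]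
  rw [measureReal_eq_sum_inter hZ, mul_sum]
  refine (sum_le_sum fun w _ => hfiber w).trans ?_
  rw [sum_comm]
  have hswap : ∀ s, ∑ w, ∑ r ∈ range (L + T + 1), μ.real ({ω | X s ω = Y r ω} ∩ {ω | Z ω = w}) =
      ∑ r ∈ range (L + T + 1), μ.real {ω | X s ω = Y r ω} := by
    intro s
    rw [sum_comm]
    exact sum_congr rfl fun r _ => (measureReal_eq_sum_inter hZ _).symm
  simp_rw [hswap]
  refine (sum_le_sum fun s _ => sum_le_sum fun r _ => hmeet s r).trans (le_of_eq ?_)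
  simp only [sum_const, card_range, nsmul_eq_mul]
  ring

lemma measure_meet_low_score_le [IsProbabilityMeasure μ] (hX : IsTorusWalk n μ X)
    (hY : IsTorusWalk n μ Y) (hind : IndepFun (fun ω t => X t ω) (fun ω t => Y t ω) μ)
    (h0 : ∀ y : Torus4 n, μ.real {ω | Y 0 ω = y} = 1 / (n : ℝ) ^ 4) {T : ℕ} (hT1 : 1 ≤ T)
    (hT : T ≤ n ^ 2) (K L : ℕ) :
    μ.real {ω | ∃ s ≤ K, ∃ t ≤ L, X s ω = Y t ω ∧
        score n T t (fun r => Y r ω) < meanScore n T / 2} ≤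
      ((K + 1 : ℕ) : ℝ) * ((L + 1 : ℕ) : ℝ) * (1 / (n : ℝ) ^ 4 *
        (8 * 625 ^ 2 * 7200 ^ 2 / ∑ k ∈ range T, 1 / ((k : ℝ) + 1))) := by
  set δ : ℝ := 1 / (n : ℝ) ^ 4 *
    (8 * 625 ^ 2 * 7200 ^ 2 / ∑ k ∈ range T, 1 / ((k : ℝ) + 1)) with hδ
  have hst : ∀ s t, μ.real {ω | X s ω = Y t ω ∧
      score n T t (fun r => Y r ω) < meanScore n T / 2} ≤ δ := by
    intro s t
    have h := measureReal_meet_inter_le hX hind s (t + T) δ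
      (fun z => {y | y t = z ∧ score n T t y < meanScore n T / 2})
      (fun z => determinedBy_score T t z _) (fun z => ?_)
    · simpa only [Set.mem_ofPred_eq, eq_comm] using h
    · have h := measure_low_score_le hY (t := t) hT1 hT z
      rwa [measureReal_eq_of_uniform hY h0] at h
  have hsub : {ω | ∃ s ≤ K, ∃ t ≤ L, X s ω = Y t ω ∧
      score n T t (fun r => Y r ω) < meanScore n T / 2} ⊆
      ⋃ p ∈ range (K + 1) ×ˢ range (L + 1), {ω | X p.1 ω = Y p.2 ω ∧
        score n T p.2 (fun r => Y r ω) < meanScore n T / 2} := by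
    rintro ω ⟨s, hs, t, ht, h⟩
    simp only [Set.mem_iUnion]
    exact ⟨(s, t), mem_product.mpr ⟨mem_range.mpr (by simpa using Nat.lt_succ_of_le hs),
      mem_range.mpr (by simpa using Nat.lt_succ_of_le ht)⟩, h⟩
  refine (measureReal_mono hsub (measure_ne_top _ _)).trans ((measureReal_biUnion_finset_le _ _).trans ?_)
  refine (sum_le_sum fun p _ => hst p.1 p.2).trans (le_of_eq ?_)
  simp only [sum_const, card_product, card_range, nsmul_eq_mul]
  push_cast
  ring

/-! ### Combining low and high scores with horizon `Nat.sqrt n` -/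

lemma half_log_le_sum (n : ℕ) (hn : 2 ≤ n) :
    Real.log n / 2 ≤ ∑ k ∈ range (Nat.sqrt n), 1 / ((k : ℝ) + 1) := by
  have h := log_add_one_le_harmonic (Nat.sqrt n)
  have h1 : ((harmonic (Nat.sqrt n) : ℚ) : ℝ) = ∑ k ∈ range (Nat.sqrt n), 1 / ((k : ℝ) + 1) := by
    simp [harmonic]
  rw [← h1]
  refine le_trans ?_ h
  have h2 : (n : ℝ) ≤ ((Nat.sqrt n + 1 : ℕ) : ℝ) ^ 2 := by
    exact_mod_cast (Nat.lt_succ_sqrt' n).le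
  have h3 := Real.log_le_log (by positivity) h2
  rw [Real.log_pow] at h3
  push_cast at h3 ⊢
  linarith

lemma measure_meet_le [IsProbabilityMeasure μ] (hX : IsTorusWalk n μ X)
    (hY : IsTorusWalk n μ Y) (hind : IndepFun (fun ω t => X t ω) (fun ω t => Y t ω) μ)
    (h0 : ∀ y : Torus4 n, μ.real {ω | Y 0 ω = y} = 1 / (n : ℝ) ^ 4) (hn : 2 ≤ n) {K L : ℕ}
    (hK : Nat.sqrt n ≤ K) (hL : Nat.sqrt n ≤ L) :
    μ.real {ω | ∃ s ≤ K, ∃ t ≤ L, X s ω = Y t ω} ≤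
      (64 * 625 ^ 2 * 7200 ^ 2 + 36 * 7200) * K * L / ((n : ℝ) ^ 4 * Real.log n) := by
  set T := Nat.sqrt n with hTdef
  have hT1 : 1 ≤ T := Nat.sqrt_pos.mpr (by omega)
  have hT : T ≤ n ^ 2 := (Nat.sqrt_le_self n).trans (Nat.le_self_pow (by norm_num) n)
  set H : ℝ := ∑ k ∈ range T, 1 / ((k : ℝ) + 1) with hH
  have hlog : 0 < Real.log n := Real.log_pos (by exact_mod_cast hn)
  have hHlog : Real.log n / 2 ≤ H := half_log_le_sum n hn
  have hHpos : 0 < H := lt_of_lt_of_le (by positivity) hHlog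
  have hM : H / 7200 ≤ meanScore n T := le_meanScore T
  have hn0 : (0 : ℝ) < n := by exact_mod_cast NeZero.pos n
  have hT1' : (1 : ℝ) ≤ T := by exact_mod_cast hT1
  have hK' : (T : ℝ) ≤ K := by exact_mod_cast hK
  have hL' : (T : ℝ) ≤ L := by exact_mod_cast hL
  have hlow := measure_meet_low_score_le hX hY hind h0 hT1 hT K L
  have hhigh := mul_measure_hit_high_score_le hX hY hind h0 T K L (meanScore n T / 2)
    (by linarith [div_pos hHpos (by norm_num : (0 : ℝ) < 7200)])
  set pl := μ.real {ω | ∃ s ≤ K, ∃ t ≤ L, X s ω = Y t ω ∧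
    score n T t (fun r => Y r ω) < meanScore n T / 2} with hpl
  set ph := μ.real {ω | ∃ s ≤ K, ∃ t ≤ L, X s ω = Y t ω ∧
    meanScore n T / 2 ≤ score n T t (fun r => Y r ω)} with hph
  have hunion : μ.real {ω | ∃ s ≤ K, ∃ t ≤ L, X s ω = Y t ω} ≤ pl + ph := by
    refine (measureReal_mono ?_).trans (measureReal_union_le _ _)
    rintro ω ⟨s, hs, t, ht, h⟩
    rcases lt_or_ge (score n T t (fun r => Y r ω)) (meanScore n T / 2) with h' | h'
    · exact Or.inl ⟨s, hs, t, ht, h, h'⟩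
    · exact Or.inr ⟨s, hs, t, ht, h, h'⟩
  have hl : pl ≤ 4 * (K * L) * (1 / (n : ℝ) ^ 4 * (8 * 625 ^ 2 * 7200 ^ 2 / H)) := by
    refine hlow.trans (mul_le_mul_of_nonneg_right ?_ (by positivity))
    push_cast
    have h1 : (K : ℝ) + 1 ≤ 2 * K := by linarith
    have h2 : (L : ℝ) + 1 ≤ 2 * L := by linarith
    exact (mul_le_mul h1 h2 (by positivity) (by positivity)).trans (le_of_eq (by ring))
  have hh : H / 14400 * ph ≤ 9 * (K * L) * (1 / (n : ℝ) ^ 4) := by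
    refine le_trans ?_ (hhigh.trans ?_)
    · exact mul_le_mul_of_nonneg_right (by linarith) measureReal_nonneg
    · refine mul_le_mul_of_nonneg_right ?_ (by positivity)
      push_cast
      -- The lower bounds on `K` and `L` absorb the extra `T` steps that both walks need to collect
      -- coincidences.
      have h1 : (K : ℝ) + 2 * T ≤ 3 * K := by linarith
      have h2 : (L : ℝ) + T + 1 ≤ 3 * L := by linarith
      exact (mul_le_mul h1 h2 (by positivity) (by positivity)).trans (le_of_eq (by ring))
  have hh' : ph ≤ 9 * (K * L) * (1 / (n : ℝ) ^ 4) * (14400 / H) := by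
    rw [← mul_div_assoc, le_div_iff₀ hHpos]
    linarith
  calc _ ≤ pl + ph := hunion
    _ ≤ (K * L) * (1 / (n : ℝ) ^ 4) * (32 * 625 ^ 2 * 7200 ^ 2 + 18 * 7200) * (1 / H) := by
        refine (add_le_add hl hh').trans (le_of_eq ?_)
        ring
    _ ≤ (K * L) * (1 / (n : ℝ) ^ 4) * (32 * 625 ^ 2 * 7200 ^ 2 + 18 * 7200) *
        (1 / (Real.log n / 2)) := by gcongr
    _ = _ := by
        field_simp
        ring

end Pair

end TorusWalk

/-! ### Large and small side lengths -/

theorem mainTheorem5 :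
    ∀ C' : ℝ, 0 < C' → ∃ C : ℝ, 0 < C ∧
      ∀ n : ℕ, 2 ≤ n →
      ∀ (Ω : Type*) [MeasurableSpace Ω] (μ : Measure Ω) [IsProbabilityMeasure μ]
        (X Y : ℕ → Ω → Torus4 n),
        IsTorusWalk n μ X → IsTorusWalk n μ Y →
        IndepFun (fun ω t => X t ω) (fun ω t => Y t ω) μ →
        (∀ y : Torus4 n, μ.real {ω | Y 0 ω = y} = 1 / (n : ℝ) ^ 4) →
        ∀ K L : ℕ, C' * n * Real.log n ≤ K → C' * n * Real.log n ≤ L →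
          μ.real {ω | ∃ s ≤ K, ∃ t ≤ L, X s ω = Y t ω} ≤
            C * K * L / ((n : ℝ) ^ 4 * Real.log n) := by
  intro C' hC'
  have hlog2 : 0 < Real.log 2 := Real.log_pos (by norm_num)
  refine ⟨(64 * 625 ^ 2 * 7200 ^ 2 + 36 * 7200) +
    16 / ((C' * Real.log 2) ^ 4 * (C' ^ 2 * Real.log 2)), by positivity, ?_⟩
  intro n hn Ω _ μ _ X Y hX hY hind h0 K L hK hL
  have : NeZero n := ⟨by omega⟩
  have hn0 : (0 : ℝ) < n := by exact_mod_cast NeZero.pos n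
  have hlogn : Real.log 2 ≤ Real.log n := Real.log_le_log (by norm_num) (by exact_mod_cast hn)
  have hlog : 0 < Real.log n := hlog2.trans_le hlogn
  have hmul : C' * n * Real.log 2 ≤ C' * n * Real.log n := by gcongr
  set c₁ : ℝ := 64 * 625 ^ 2 * 7200 ^ 2 + 36 * 7200 with hc₁
  set c₂ : ℝ := 16 / ((C' * Real.log 2) ^ 4 * (C' ^ 2 * Real.log 2)) with hc₂
  have hc₂pos : 0 < c₂ := by positivity
  have hsplit : (c₁ + c₂) * K * L / ((n : ℝ) ^ 4 * Real.log n) =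
      c₁ * K * L / ((n : ℝ) ^ 4 * Real.log n) + c₂ * K * L / ((n : ℝ) ^ 4 * Real.log n) := by ring
  rw [hsplit]
  -- If this fails, then `n * (C' * log 2) ^ 2 ≤ 4`, so `n` is bounded in terms of `C'`. The second
  -- summand of the constant is chosen so that the right side is then at least `1`.
  by_cases hT : (Nat.sqrt n : ℝ) ≤ C' * n * Real.log 2
  · have h1 := TorusWalk.measure_meet_le hX hY hind h0 hn
      (by exact_mod_cast (hT.trans (hmul.trans hK))) (by exact_mod_cast (hT.trans (hmul.trans hL)))
    exact h1.trans (le_add_of_nonneg_right (by positivity))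
  · push Not at hT
    have h1 : μ.real {ω | ∃ s ≤ K, ∃ t ≤ L, X s ω = Y t ω} ≤ 1 := measureReal_le_one
    refine h1.trans (le_add_of_nonneg_of_le (by positivity) ?_)
    set T := Nat.sqrt n with hTdef
    have hT1 : (1 : ℝ) ≤ T := by exact_mod_cast (Nat.sqrt_pos.mpr (by omega) : 0 < T)
    have hTn : (T : ℝ) ^ 2 ≤ n := by exact_mod_cast Nat.sqrt_le' n
    have hnT : (n : ℝ) ≤ (T + 1) ^ 2 := by exact_mod_cast (Nat.lt_succ_sqrt' n).le
    set a := C' * Real.log 2 with ha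
    have ha0 : 0 < a := by positivity
    have hTa : T * a < 1 := by
      have h2 : a * T ^ 2 < T := by
        refine lt_of_le_of_lt ?_ hT
        calc a * (T : ℝ) ^ 2 ≤ a * n := by gcongr
          _ = C' * n * Real.log 2 := by rw [ha]; ring
      have : T * (T * a) < T * 1 := by linarith
      exact lt_of_mul_lt_mul_left this (by linarith)
    have hna : n * a ^ 2 ≤ 4 := by
      have h3 : (n : ℝ) ≤ 4 * T ^ 2 := by nlinarith
      have h4 : (T * a) ^ 2 ≤ 1 := pow_le_one₀ (by positivity) hTa.le
      calc n * a ^ 2 ≤ 4 * T ^ 2 * a ^ 2 := by gcongr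
        _ = 4 * (T * a) ^ 2 := by ring
        _ ≤ 4 := by linarith
    have hna2 : (n : ℝ) ^ 2 * a ^ 4 ≤ 16 := by
      have : (n * a ^ 2) ^ 2 ≤ 4 ^ 2 := pow_le_pow_left₀ (by positivity) hna 2
      nlinarith
    have hKL : (C' * n * Real.log n) * (C' * n * Real.log n) ≤ K * L :=
      mul_le_mul hK hL (by positivity) (by positivity)
    rw [le_div_iff₀ (by positivity), one_mul, mul_assoc]
    refine le_trans ?_ (mul_le_mul_of_nonneg_left hKL hc₂pos.le)
    have hc : (n : ℝ) ^ 2 ≤ c₂ * (C' ^ 2 * Real.log 2) := by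
      have : c₂ * (C' ^ 2 * Real.log 2) = 16 / a ^ 4 := by
        rw [hc₂]
        field_simp
      rw [this, le_div_iff₀ (by positivity)]
      exact hna2
    calc (n : ℝ) ^ 4 * Real.log n = n ^ 2 * Real.log n * n ^ 2 := by ring
      _ ≤ n ^ 2 * Real.log n * (c₂ * (C' ^ 2 * Real.log n)) := by
          gcongr
          exact hc.trans (by gcongr)
      _ = _ := by ring
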